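/- Let $\mathcal X$ be a complex Banach space and let $E,A$ be bounded linear operators on $\mathcal X$, where $E$ is not boundedly invertible. Put $\rho(E,A)=\{s\in\mathbb C : sE-A \text{ is bijective}\}$ and $\sigma(E,A)=\mathbb C\setminus\rho(E,A)$, and assume that the pencil $(E,A)$ is regular, i.e. $\rho(E,A)\neq\emptyset$. The Wong sequences of $(E,A)$ are the subspaces defined by $N_0=\{0\}$, $R_0=\mathcal X$, $N_{k+1}=E^{-1}(AN_k)$ and $R_{k+1}=A^{-1}(ER_k)$ for $k\ge 0$, where $E^{-1}(\cdot)$ and $A^{-1}(\cdot)$ denote preimages. Then for every integer $m\ge 1$ the following statements are equivalent: (i) $(E,A)$ has finite index $m$, i.e. $\sigma(E,A)$ is bounded, and $\|(sE-A)^{-1}\|=O(|s|^{m-1})$ but $\|(sE-A)^{-1}\|\neq O(|s|^{m-2})$ as $|s|\to\infty$. (ii) $\sigma(E,A)$ is bounded, and $m$ is the least integer $k\ge 1$ with $R_{k+1}=R_k$. (iii) $m$ is the least integer $k\ge 1$ with $\mathcal X=N_k\oplus R_k$ (direct sum of subspaces). (iv) $m$ is the least integer $k\ge 1$ with both $R_{k+1}=R_k$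 and $N_{k+1}=N_k$. (v) There is a sequence $(s_n)\subset\rho(E,A)$ with $|s_n|\to\infty$ such that $\|(s_nE-A)^{-1}\|=O(|s_n|^{m-1})$ but $\|(s_nE-A)^{-1}\|\neq O(|s_n|^{m-2})$ as $n\to\infty$; and $R_m$ is closed. (vi) There is a sequence $(s_n)$ as in (v), and $R_{k+1}=R_k$ for some integer $k\ge 0$. -/

import Mathlib

open Filter Bornology Asymptotics

namespace OperatorPencil

variable {X : Type*} [NormedAddCommGroup X] [NormedSpace ℂ X]

/-- The resolvent set `ρ(E, A)` of the pencil `s E - A`. -/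
def pencilResolventSet (E A : X →L[ℂ] X) : Set ℂ :=
  {s : ℂ | Function.Bijective (s • E - A)}

/-- The (finite) spectrum `σ(E, A)` of the pencil `s E - A`; the point `∞` is not included. -/
def pencilSpectrum (E A : X →L[ℂ] X) : Set ℂ :=
  (pencilResolventSet E A)ᶜ

/-- The pencil is regular if its resolvent set is nonempty. -/
def IsRegular (E A : X →L[ℂ] X) : Prop :=
  (pencilResolventSet E A).Nonempty

/-- The resolvent `(s E - A)⁻¹`, as a bounded operator. On a Banach space it is the inverse of
`s E - A` for every `s ∈ ρ(E, A)`; elsewhere it has the junk value `0`. -/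
noncomputable def pencilResolvent (E A : X →L[ℂ] X) (s : ℂ) : X →L[ℂ] X :=
  Ring.inverse (s • E - A)

/-- The ascending Wong sequence: `N 0 = {0}` and `N (k + 1) = E⁻¹ (A (N k))` (a preimage). -/
def wongN (E A : X →L[ℂ] X) : ℕ → Submodule ℂ X
  | 0 => ⊥
  | k + 1 => ((wongN E A k).map (A : X →ₗ[ℂ] X)).comap (E : X →ₗ[ℂ] X)

/-- The descending Wong sequence: `R 0 = X` and `R (k + 1) = A⁻¹ (E (R k))` (a preimage). -/
def wongR (E A : X →L[ℂ] X) : ℕ → Submodule ℂ X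
  | 0 => ⊤
  | k + 1 => ((wongR E A k).map (E : X →ₗ[ℂ] X)).comap (A : X →ₗ[ℂ] X)

/-- The pencil has finite index `m`: its spectrum is bounded and, as `|s| → ∞`,
`‖(s E - A)⁻¹‖ = O(|s| ^ (m - 1))` but not `O(|s| ^ (m - 2))` (integer exponents). -/
def HasFiniteIndex (E A : X →L[ℂ] X) (m : ℕ) : Prop :=
  IsBounded (pencilSpectrum E A) ∧
    (fun s : ℂ => ‖pencilResolvent E A s‖) =O[cobounded ℂ] (fun s : ℂ => ‖s‖ ^ ((m : ℤ) - 1)) ∧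
    ¬ (fun s : ℂ => ‖pencilResolvent E A s‖) =O[cobounded ℂ] (fun s : ℂ => ‖s‖ ^ ((m : ℤ) - 2))

/-- `s n ∈ ρ(E, A)`, `|s n| → ∞` and `‖(s n E - A)⁻¹‖ = O(|s n| ^ (m - 1))` as `n → ∞`,
where `m` is minimal, i.e. the norm is not `O(|s n| ^ (m - 2))`. -/
def HasGrowthAlong (E A : X →L[ℂ] X) (m : ℕ) (s : ℕ → ℂ) : Prop :=
  (∀ n, s n ∈ pencilResolventSet E A) ∧
    Tendsto (fun n => ‖s n‖) atTop atTop ∧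
    (fun n => ‖pencilResolvent E A (s n)‖) =O[atTop] (fun n => ‖s n‖ ^ ((m : ℤ) - 1)) ∧
    ¬ (fun n => ‖pencilResolvent E A (s n)‖) =O[atTop] (fun n => ‖s n‖ ^ ((m : ℤ) - 2))

end OperatorPencil

namespace OperatorPencil

variable {X : Type*} [NormedAddCommGroup X] [NormedSpace ℂ X]

/-! ### Ascent and descent of an operator -/

/-! Fix `μ` in the resolvent set and put `B = μE - A`, `T = B⁻¹E`. Then `sE - A = B (1 + (s - μ)
T)`, and the Wong sequences become `N_k = ker T^k` and `R_k = ran T^k`. Every condition thus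
concerns the ascent and descent of `T` and the growth of `(1 + zT)⁻¹`; (iii) and (iv) both say that
`m` is the least positive exponent at which kernels and ranges are stationary, and the other
statements are compared with this one.

From ascent and descent at most `k` comes a Drazin inverse of `T`, and with it an explicit formula
for `(1 + zT)⁻¹`, valid for large `z` and of size `O(|z|^(k-1))`
(`eventually_isUnit_and_isBigO_inverse`). Conversely, growth `O(|z|^(q-1))` along any `|z| → ∞`
bounds the ascent by `q` (`ascentLE_of_isBigO`). The descent follows if the bound holds near
infinity (a pole), if `ran T^q` is closed (surjectivity is stable), or from some finite descent. For
(ii), finite descent and invertibility of `1 + zT` for large `z` give finite ascent. Failure of the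
bound with exponent `m - 2` encodes minimality; non-invertibility of `E` is what settles `m = 1`. -/

/-- The kernels of the powers of `T` are stationary from the exponent `k` on. -/
def AscentLE (T : X →L[ℂ] X) (k : ℕ) : Prop :=
  ∀ x, (T ^ (k + 1)) x = 0 → (T ^ k) x = 0

/-- The ranges of the powers of `T` are stationary from the exponent `k` on. -/
def DescentLE (T : X →L[ℂ] X) (k : ℕ) : Prop :=
  ∀ x, ∃ y, (T ^ (k + 1)) y = (T ^ k) x

theorem pow_add_apply (T : X →L[ℂ] X) (i j : ℕ) (x : X) :
    (T ^ (i + j)) x = (T ^ i) ((T ^ j) x) := by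
  rw [pow_add]; rfl

theorem pow_add_apply' (T : X →L[ℂ] X) (i j : ℕ) (x : X) :
    (T ^ (i + j)) x = (T ^ j) ((T ^ i) x) := by
  rw [add_comm, pow_add_apply]

theorem pow_apply_comm (T : X →L[ℂ] X) (i j : ℕ) (x : X) :
    (T ^ i) ((T ^ j) x) = (T ^ j) ((T ^ i) x) := by
  rw [← pow_add_apply, pow_add_apply']

theorem AscentLE.apply_eq_zero {T : X →L[ℂ] X} {k : ℕ} (h : AscentLE T k) (i : ℕ) :
    ∀ x, (T ^ (k + i)) x = 0 → (T ^ k) x = 0 := by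
  induction i with
  | zero => exact fun x hx => hx
  | succ i ih =>
    intro x hx
    have h2 : (T ^ k) ((T ^ i) x) = 0 := by
      apply h
      rw [← pow_add_apply, ← hx]
      congr 2; ring
    exact ih x (by rw [pow_add_apply, h2])

theorem DescentLE.exists_apply_eq {T : X →L[ℂ] X} {k : ℕ} (h : DescentLE T k) (i : ℕ) :
    ∀ x, ∃ y, (T ^ (k + i)) y = (T ^ k) x := by
  induction i with
  | zero => exact fun x => ⟨x, rfl⟩
  | succ i ih =>
    intro x
    obtain ⟨y, hy⟩ := ih x
    obtain ⟨z, hz⟩ := h y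
    refine ⟨z, ?_⟩
    rw [← hy, pow_add_apply' T k i y, ← hz, ← pow_add_apply]
    congr 2; ring

theorem DescentLE.mono {T : X →L[ℂ] X} {k l : ℕ} (h : DescentLE T k) (hkl : k ≤ l) :
    DescentLE T l := by
  obtain ⟨i, rfl⟩ := Nat.exists_eq_add_of_le hkl
  intro x
  obtain ⟨y, hy⟩ := h x
  refine ⟨y, ?_⟩
  rw [pow_add_apply' T k i x, ← hy, ← pow_add_apply]
  congr 2; ring

/-- If the kernels are stationary from `a` on and the ranges from some exponent on, then the
ranges are stationary from `a` on. -/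
theorem DescentLE.of_ascentLE {T : X →L[ℂ] X} {a d : ℕ} (hd : DescentLE T d)
    (ha : AscentLE T a) : DescentLE T a := by
  intro x
  obtain ⟨y, hy⟩ := hd.mono (le_max_right a d) x
  obtain ⟨i, hi⟩ := Nat.exists_eq_add_of_le (le_max_left a d)
  refine ⟨y, ?_⟩
  -- Descent is available only at the larger exponent `a + i`; the ascent bound cancels the surplus
  -- `T ^ i`.
  have h1 : (T ^ (a + i)) (T y - x) = 0 := by
    rw [map_sub, sub_eq_zero, ← hi, ← hy, pow_succ]; rfl
  have h2 := ha.apply_eq_zero i _ h1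
  rw [map_sub, sub_eq_zero] at h2
  rw [pow_succ]; exact h2

/-- If the ranges are stationary from `d` on and the kernels from some exponent on, then the
kernels are stationary from `d` on. -/
theorem AscentLE.of_descentLE {T : X →L[ℂ] X} {a d : ℕ} (ha : AscentLE T a)
    (hd : DescentLE T d) : AscentLE T d := by
  intro x hx
  -- With `T^d x = T^(d+a) y`, the vector `y` lies in `ker T^(a+d+1) = ker T^a`.
  obtain ⟨y, hy⟩ := hd.exists_apply_eq a x
  have h1 : (T ^ (a + (d + 1))) y = 0 := by
    have : (T ^ 1) ((T ^ d) x) = 0 := by rw [← pow_add_apply', hx]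
    rw [← hy, ← pow_add_apply] at this
    rw [← this]; congr 2; ring
  rw [← hy, pow_add_apply, ha.apply_eq_zero _ y h1, map_zero]

theorem isUnit_of_ascentLE_zero_of_descentLE_zero [CompleteSpace X] {T : X →L[ℂ] X}
    (ha : AscentLE T 0) (hd : DescentLE T 0) : IsUnit T := by
  rw [ContinuousLinearMap.isUnit_iff_bijective]
  constructor
  · rw [injective_iff_map_eq_zero]
    intro x hx
    simpa using ha x (by simpa using hx)
  · intro x
    obtain ⟨y, hy⟩ := hd x
    exact ⟨y, by simpa using hy⟩

/-! ### The Wong sequences in terms of kernels and ranges of powers -/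

theorem mem_wongN_iff {B : X →L[ℂ] X} (hB : IsUnit B) (T : X →L[ℂ] X) (μ : ℂ) (k : ℕ) (x : X) :
    x ∈ wongN (B * T) (B * (μ • T - 1)) k ↔ (T ^ k) x = 0 := by
  have hinj : Function.Injective B := by
    obtain ⟨u, rfl⟩ := hB
    exact (ContinuousLinearEquiv.ofUnit u).injective
  induction k generalizing x with
  | zero => simp [wongN]
  | succ k ih =>
    have key : x ∈ wongN (B * T) (B * (μ • T - 1)) (k + 1) ↔
        ∃ n, (T ^ k) n = 0 ∧ (μ • T - 1) n = T x := by
      simp only [wongN, Submodule.mem_comap, Submodule.mem_map, ih]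
      exact exists_congr fun n => and_congr_right fun _ => hinj.eq_iff
    rw [key]
    constructor
    · rintro ⟨n, hn, h⟩
      have : (T ^ k * (μ • T - 1)) n = ((μ • T - 1) * T ^ k) n := by
        rw [((Commute.refl T).pow_left k).smul_right μ |>.sub_right (Commute.one_right _) |>.eq]
      rw [pow_succ]
      change (T ^ k) (T x) = 0
      rw [← h]
      refine this.trans ?_
      change (μ • T - 1) ((T ^ k) n) = 0
      rw [hn, map_zero]
    · intro hx
      -- On `ker T^k` the operator `μT - 1` is inverted by `-G`, a terminating Neumann series.
      set G : X →L[ℂ] X := ∑ j ∈ Finset.range k, (μ • T) ^ j with hG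
      have hc : Commute (T ^ k) G := Commute.sum_right _ _ _ fun j _ =>
        (((Commute.refl T).smul_right μ).pow_pow k j)
      have hx' : (T ^ k) (T x) = 0 := by rw [← hx, pow_succ]; rfl
      refine ⟨-(G (T x)), ?_, ?_⟩
      · rw [map_neg, neg_eq_zero]
        change (T ^ k * G) (T x) = 0
        rw [hc.eq]
        change G ((T ^ k) (T x)) = 0
        rw [hx', map_zero]
      · rw [map_neg]
        change -(((μ • T - 1) * G) (T x)) = T x
        rw [hG, mul_geom_sum, smul_pow]
        simp [hx']

theorem mem_wongR_iff {B : X →L[ℂ] X} (hB : IsUnit B) (T : X →L[ℂ] X) (μ : ℂ) (k : ℕ) (x : X) :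
    x ∈ wongR (B * T) (B * (μ • T - 1)) k ↔ ∃ y, (T ^ k) y = x := by
  have hinj : Function.Injective B := by
    obtain ⟨u, rfl⟩ := hB
    exact (ContinuousLinearEquiv.ofUnit u).injective
  induction k generalizing x with
  | zero => simp [wongR]
  | succ k ih =>
    have key : x ∈ wongR (B * T) (B * (μ • T - 1)) (k + 1) ↔
        ∃ y, T ((T ^ k) y) = (μ • T - 1) x := by
      simp only [wongR, Submodule.mem_comap, Submodule.mem_map, ih]
      constructor
      · rintro ⟨_, ⟨y, rfl⟩, h⟩
        exact ⟨y, hinj h⟩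
      · rintro ⟨y, h⟩
        exact ⟨_, ⟨y, rfl⟩, congrArg B h⟩
    rw [key]
    constructor
    · rintro ⟨y, hy⟩
      -- The relation `x = μTx - T^(k+1) y` raises by one the power of `T` through which `x`
      -- factors, until `k + 1` is reached.
      have step : ∀ j ≤ k + 1, ∃ z, (T ^ j) z = x := by
        intro j
        induction j with
        | zero => exact fun _ => ⟨x, by simp⟩
        | succ j ihj =>
          intro hj
          obtain ⟨z, rfl⟩ := ihj (by omega)
          obtain ⟨i, rfl⟩ := Nat.exists_eq_add_of_le (show j ≤ k by omega)
          refine ⟨μ • z - (T ^ i) y, ?_⟩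
          have h1 : (T ^ j) z = μ • T ((T ^ j) z) - T ((T ^ (j + i)) y) := by
            rw [hy]; simp
          rw [pow_succ']
          change T ((T ^ j) _) = _
          rw [h1, map_sub, map_sub, map_smul, map_smul, ← pow_add_apply]
      exact step _ le_rfl
    · rintro ⟨y, rfl⟩
      refine ⟨(μ • T - 1) y, ?_⟩
      change (T * T ^ k * (μ • T - 1)) y = ((μ • T - 1) * T ^ (k + 1)) y
      rw [← pow_succ', ((Commute.refl T).pow_left (k + 1)).smul_right μ |>.sub_right
        (Commute.one_right _) |>.eq]

theorem wongN_succ_eq_iff {B : X →L[ℂ] X} (hB : IsUnit B) (T : X →L[ℂ] X) (μ : ℂ) (k : ℕ) :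
    wongN (B * T) (B * (μ • T - 1)) (k + 1) = wongN (B * T) (B * (μ • T - 1)) k ↔
      AscentLE T k := by
  simp only [SetLike.ext_iff, mem_wongN_iff hB]
  refine ⟨fun h x => (h x).1, fun h x => ⟨h x, fun hx => ?_⟩⟩
  rw [pow_add_apply', hx, map_zero]

theorem wongR_succ_eq_iff {B : X →L[ℂ] X} (hB : IsUnit B) (T : X →L[ℂ] X) (μ : ℂ) (k : ℕ) :
    wongR (B * T) (B * (μ • T - 1)) (k + 1) = wongR (B * T) (B * (μ • T - 1)) k ↔
      DescentLE T k := by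
  simp only [SetLike.ext_iff, mem_wongR_iff hB]
  refine ⟨fun h x => (h _).2 ⟨x, rfl⟩, fun h x => ⟨?_, ?_⟩⟩
  · rintro ⟨y, rfl⟩
    exact ⟨T y, by rw [pow_succ]; rfl⟩
  · rintro ⟨y, rfl⟩
    exact h y

/-- Applying `T^k` to `x = n + T^k y` gives `T^k x = T^(2k) y`, and `2k ≥ k + 1` because `k ≥ 1`. At
`k = 0` the decomposition is trivial and carries no information. -/
theorem isCompl_wongN_wongR_iff {B : X →L[ℂ] X} (hB : IsUnit B) (T : X →L[ℂ] X) (μ : ℂ) {k : ℕ}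
    (hk : 1 ≤ k) :
    IsCompl (wongN (B * T) (B * (μ • T - 1)) k) (wongR (B * T) (B * (μ • T - 1)) k) ↔
      DescentLE T k ∧ AscentLE T k := by
  rw [isCompl_iff, Submodule.disjoint_def, codisjoint_iff, Submodule.eq_top_iff']
  simp only [Submodule.mem_sup, mem_wongN_iff hB, mem_wongR_iff hB]
  obtain ⟨i, rfl⟩ := Nat.exists_eq_add_of_le hk
  constructor
  · rintro ⟨h1, h2⟩
    refine ⟨fun x => ?_, fun x hx => ?_⟩
    · obtain ⟨n, hn, _, ⟨y, rfl⟩, rfl⟩ := h2 x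
      refine ⟨(T ^ i) y, ?_⟩
      rw [map_add, hn, zero_add, ← pow_add_apply, ← pow_add_apply]
      congr 2; ring
    · refine h1 _ ?_ ⟨x, rfl⟩
      have : (T ^ i) ((T ^ (1 + i + 1)) x) = 0 := by rw [hx, map_zero]
      rw [← pow_add_apply] at this ⊢
      rw [← this]; congr 2; ring
  · rintro ⟨hd, ha⟩
    refine ⟨?_, fun x => ?_⟩
    · rintro _ hx ⟨y, rfl⟩
      exact ha.apply_eq_zero (1 + i) y (by rw [pow_add_apply]; exact hx)
    · obtain ⟨y, hy⟩ := hd.exists_apply_eq (1 + i) x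
      refine ⟨x - (T ^ (1 + i)) y, ?_, _, ⟨y, rfl⟩, by abel⟩
      rw [map_sub, ← pow_add_apply, hy, sub_self]

/-! ### The Drazin inverse of an operator with finite ascent and descent -/

/-- If the range of `V` is contained in the range of `W`, then `V` lifts through `W` with a norm
bound. -/
theorem exists_lift_norm_le [CompleteSpace X] (V W : X →L[ℂ] X) (h : ∀ x, ∃ y, W y = V x) :
    ∃ C > 0, ∃ g : X → X, ∀ x, W (g x) = V x ∧ ‖g x‖ ≤ C * ‖x‖ := by
  -- The kernel of `D` is the closed space of pairs with `V x = W y`; it projects onto the first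
  -- factor, so the open mapping theorem bounds preimages. The selection `g` need not be linear.
  let D : X × X →L[ℂ] X :=
    V.comp (ContinuousLinearMap.fst ℂ X X) - W.comp (ContinuousLinearMap.snd ℂ X X)
  let Γ : Submodule ℂ (X × X) := LinearMap.ker (D : X × X →ₗ[ℂ] X)
  have hΓ : IsClosed (Γ : Set (X × X)) := by
    have : (Γ : Set (X × X)) = D ⁻¹' {0} := by ext; simp [Γ]
    rw [this]
    exact isClosed_singleton.preimage D.continuous
  have : CompleteSpace Γ := hΓ.completeSpace_coe
  let π : Γ →L[ℂ] X := (ContinuousLinearMap.fst ℂ X X).comp Γ.subtypeL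
  have hπ : Function.Surjective π := by
    intro x
    obtain ⟨y, hy⟩ := h x
    exact ⟨⟨(x, y), by simp [Γ, D, hy]⟩, rfl⟩
  obtain ⟨C, hC, hb⟩ := π.exists_preimage_norm_le hπ
  choose f hf1 hf2 using hb
  refine ⟨C, hC, fun x => (f x).1.2, fun x => ⟨?_, ?_⟩⟩
  · have h1 : V (f x).1.1 - W (f x).1.2 = 0 := (f x).2
    have h2 : (f x).1.1 = x := hf1 x
    rw [h2, sub_eq_zero] at h1
    exact h1.symm
  · exact (norm_snd_le (f x).1).trans (hf2 x)

/-- Set `S x = T^k y` for any solution of `T^(2k+1) y = T^k x`. Descent provides `y`; ascent makes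
`T^k y` independent of the choice, whence linearity and the algebraic identities. -/
theorem exists_drazin_inverse [CompleteSpace X] {T : X →L[ℂ] X} {k : ℕ} (ha : AscentLE T k)
    (hd : DescentLE T k) :
    ∃ S : X →L[ℂ] X, Commute T S ∧ S * T * S = S ∧ T ^ (k + 1) * S = T ^ k := by
  obtain ⟨C, hC, g, hg⟩ := exists_lift_norm_le (T ^ k) (T ^ (k + (k + 1)))
    (hd.exists_apply_eq (k + 1))
  have hg1 := fun x => (hg x).1
  have huniq : ∀ x y, (T ^ (k + (k + 1))) y = (T ^ k) x → (T ^ k) (g x) = (T ^ k) y := by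
    intro x y hy
    rw [← sub_eq_zero, ← map_sub]
    apply ha.apply_eq_zero (k + 1)
    rw [map_sub, hg1, hy, sub_self]
  let S : X →L[ℂ] X := LinearMap.mkContinuous
    { toFun := fun x => (T ^ k) (g x)
      map_add' := fun x y => by
        rw [← map_add]
        exact huniq _ _ (by rw [map_add, hg1, hg1, map_add])
      map_smul' := fun c x => by
        rw [RingHom.id_apply, ← map_smul]
        exact huniq _ _ (by rw [map_smul, hg1, map_smul]) }
    (‖T ^ k‖ * C) fun x => by
      change ‖(T ^ k) (g x)‖ ≤ _
      rw [mul_assoc]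
      exact (T ^ k).le_opNorm_of_le (hg x).2
  have hS : ∀ x, S x = (T ^ k) (g x) := fun x => rfl
  have h1 : T ^ (k + 1) * S = T ^ k := by
    ext x
    change (T ^ (k + 1)) (S x) = _
    rw [hS, ← pow_add_apply', hg1]
  have h2 : Commute T S := by
    ext x
    change T (S x) = S (T x)
    rw [hS, hS, huniq (T x) (T (g x))]
    · exact pow_apply_comm T 1 k (g x)
    · have e1 := pow_apply_comm T (k + (k + 1)) 1 (g x)
      have e2 := pow_apply_comm T 1 k x
      rw [hg1] at e1
      rw [pow_one] at e1 e2
      rw [e1, e2]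
  refine ⟨S, h2, ?_, h1⟩
  ext x
  change S (T (S x)) = S x
  rw [hS (T (S x)), hS x]
  refine huniq _ _ ?_
  rw [hg1, ← hS]
  have := DFunLike.congr_fun h1 x
  rw [← this, pow_succ]; rfl

theorem commute_ringInverse_right {R : Type*} [MonoidWithZero R] {a b : R} (h : Commute a b) :
    Commute a (Ring.inverse b) := by
  by_cases hb : IsUnit b
  · obtain ⟨u, rfl⟩ := hb
    rw [Ring.inverse_unit]
    exact h.units_inv_right
  · rw [Ring.inverse_non_unit _ hb]
    exact Commute.zero_right a

/-- The inverse of `1 + z T` in terms of a Drazin inverse `S` of `T`, for `1 + z⁻¹ S` invertible. -/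
theorem inverse_one_add_smul_eq {T S : X →L[ℂ] X} {k : ℕ} (hc : Commute T S)
    (hS : S * T * S = S) (hk : T ^ (k + 1) * S = T ^ k) {z : ℂ} (hz : z ≠ 0)
    (hu : IsUnit (1 + z⁻¹ • S)) :
    IsUnit (1 + z • T) ∧ Ring.inverse (1 + z • T) =
      z⁻¹ • (S * Ring.inverse (1 + z⁻¹ • S)) +
        (∑ j ∈ Finset.range k, (-(z • T)) ^ j) * (1 - T * S) := by
  set V := Ring.inverse (1 + z⁻¹ • S) with hV
  set G := ∑ j ∈ Finset.range k, (-(z • T)) ^ j with hG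
  set Z := z⁻¹ • (S * V) + G * (1 - T * S) with hZ
  have hV1 : (1 + z⁻¹ • S) * V = 1 := Ring.mul_inverse_cancel _ hu
  have hTV : Commute T V := commute_ringInverse_right
    ((Commute.one_right T).add_right (hc.smul_right _))
  have hTG : Commute T G := Commute.sum_right _ _ _ fun j _ =>
    (((Commute.refl T).smul_right z).neg_right.pow_right j)
  have hTZ : Commute T Z := ((hc.mul_right hTV).smul_right _).add_right
    (hTG.mul_right ((Commute.one_right T).sub_right ((Commute.refl T).mul_right hc)))
  -- The idempotent `TS` splits the inverse: on its range `S` inverts `T`, while on the complement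
  -- `T^k` vanishes and the geometric series for `1 + zT` terminates.
  have e1 : (1 + z • T) * (z⁻¹ • (S * V)) = T * S := by
    have : (1 + z • T) * S = z • (T * S * (1 + z⁻¹ • S)) := by
      have h3 : T * S * S = S := by rw [hc.eq, hS]
      rw [mul_add, mul_one, mul_smul_comm, h3, smul_add, smul_smul, mul_inv_cancel₀ hz, one_smul,
        add_mul, one_mul, smul_mul_assoc, add_comm]
    rw [mul_smul_comm, ← mul_assoc, this, smul_mul_assoc, smul_smul, inv_mul_cancel₀ hz, one_smul,
      mul_assoc, hV1, mul_one]
  have e2 : (1 + z • T) * (G * (1 - T * S)) = 1 - T * S := by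
    have h3 : (1 + z • T) * G = 1 - (-(z • T)) ^ k := by
      rw [hG, ← mul_neg_geom_sum, sub_neg_eq_add]
    have h4 : (-(z • T)) ^ k * (1 - T * S) = 0 := by
      rw [← neg_smul, smul_pow, smul_mul_assoc, mul_sub, mul_one, ← mul_assoc, ← pow_succ, hk,
        sub_self, smul_zero]
    rw [← mul_assoc, h3, sub_mul, h4, sub_zero, one_mul]
  have e3 : (1 + z • T) * Z = 1 := by rw [hZ, mul_add, e1, e2]; abel
  have hcZ : Commute (1 + z • T) Z := (Commute.one_left Z).add_left (hTZ.smul_left z)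
  have hunit : IsUnit (1 + z • T) := (hcZ.isUnit_mul_iff.1 (by rw [e3]; exact isUnit_one)).1
  refine ⟨hunit, ?_⟩
  have := Ring.inverse_mul_cancel_left (1 + z • T) Z hunit
  rw [← this, e3, mul_one]

theorem isBigO_zpow_of_le {ι : Type*} {l : Filter ι} {f : ι → ℝ} (hf : Tendsto f l atTop)
    {p q : ℤ} (hpq : p ≤ q) : (fun n => f n ^ p) =O[l] fun n => f n ^ q := by
  refine IsBigO.of_bound 1 ?_
  filter_upwards [hf.eventually_ge_atTop 1] with n hn
  rw [one_mul, Real.norm_of_nonneg (by positivity), Real.norm_of_nonneg (by positivity)]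
  exact zpow_le_zpow_right₀ hn hpq

theorem isBigO_geom_sum {ι : Type*} {l : Filter ι} {z : ι → ℂ}
    (hz : Tendsto (fun n => ‖z n‖) l atTop) (T : X →L[ℂ] X) (k : ℕ) :
    (fun n => ∑ j ∈ Finset.range k, (-(z n • T)) ^ j) =O[l] fun n => ‖z n‖ ^ ((k : ℤ) - 1) := by
  refine IsBigO.fun_sum fun j hj => ?_
  have h1 : (fun n => (-(z n • T)) ^ j) =O[l] fun n => ‖z n‖ ^ (j : ℤ) := by
    refine IsBigO.of_bound ‖T ^ j‖ (Eventually.of_forall fun n => ?_)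
    rw [← neg_smul, smul_pow, norm_smul, norm_pow, norm_neg, norm_zpow, norm_norm, zpow_natCast,
      mul_comm]
  refine h1.trans (isBigO_zpow_of_le hz ?_)
  have := Finset.mem_range.1 hj
  omega

theorem eventually_isUnit_and_isBigO_inverse [CompleteSpace X] {T : X →L[ℂ] X} {k : ℕ}
    (hk : 1 ≤ k) (ha : AscentLE T k) (hd : DescentLE T k) :
    (∀ᶠ z in cobounded ℂ, IsUnit (1 + z • T)) ∧
      (fun z : ℂ => Ring.inverse (1 + z • T)) =O[cobounded ℂ] fun z => ‖z‖ ^ ((k : ℤ) - 1) := by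
  obtain ⟨S, hc, hS, hkS⟩ := exists_drazin_inverse ha hd
  have hlim : Tendsto (fun z : ℂ => -(z⁻¹ • S)) (cobounded ℂ) (nhds 0) := by
    have := (tendsto_inv₀_cobounded (α := ℂ)).smul_const S
    simpa using this.neg
  have hunit : ∀ᶠ z : ℂ in cobounded ℂ, IsUnit (1 + z⁻¹ • S) := by
    have h0 : Tendsto (fun z : ℂ => 1 + z⁻¹ • S) (cobounded ℂ) (nhds 1) := by
      simpa using (tendsto_const_nhds (x := (1 : X →L[ℂ] X))).sub hlim
    exact h0.eventually (Units.nhds 1)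
  have hne : ∀ᶠ z : ℂ in cobounded ℂ, z ≠ 0 := eventually_ne_cobounded 0
  have hev := hunit.and hne
  refine ⟨hev.mono fun z hz => (inverse_one_add_smul_eq hc hS hkS hz.2 hz.1).1, ?_⟩
  refine IsBigO.congr' ?_ (hev.mono fun z hz =>
    (inverse_one_add_smul_eq hc hS hkS hz.2 hz.1).2.symm) EventuallyEq.rfl
  have hnorm : Tendsto (fun z : ℂ => ‖z‖) (cobounded ℂ) atTop := tendsto_norm_cobounded_atTop
  refine IsBigO.add ?_ ?_
  · have h1 : (fun z : ℂ => Ring.inverse (1 + z⁻¹ • S)) =O[cobounded ℂ] fun _ => (1 : ℝ) := by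
      have := (NormedRing.inverse_one_sub_norm (R := X →L[ℂ] X)).comp_tendsto hlim
      simpa [Function.comp_def, sub_neg_eq_add] using this
    have h2 : (fun z : ℂ => z⁻¹) =O[cobounded ℂ] fun _ => (1 : ℝ) :=
      tendsto_inv₀_cobounded.isBigO_one ℝ
    have h3 := h2.smul ((isBigO_const_const S (one_ne_zero (α := ℝ)) (cobounded ℂ)).mul h1)
    refine h3.trans ?_
    -- The Drazin term is merely estimated by `O(1)`, which `k ≥ 1` absorbs.
    have h4 := isBigO_zpow_of_le hnorm (show (0 : ℤ) ≤ (k : ℤ) - 1 by omega)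
    simpa using h4
  · have h1 := (isBigO_geom_sum hnorm T k).mul
      (isBigO_const_const (1 - T * S) (one_ne_zero (α := ℝ)) (cobounded ℂ))
    simpa using h1

/-! ### Consequences of the growth of the resolvent -/

/-- Expanding, `(1 + zT)⁻¹ = ∑_{j<q} (-zT)^j + (-z)^q T^q (1 + zT)⁻¹`. The sum is itself
`O(|z|^(q-1))`, so the last term is too, and division by `z^q` leaves `O(|z|⁻¹)`. -/
theorem tendsto_pow_mul_inverse {ι : Type*} {l : Filter ι} {z : ι → ℂ}
    (hz : Tendsto (fun n => ‖z n‖) l atTop) {T : X →L[ℂ] X}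
    (hu : ∀ᶠ n in l, IsUnit (1 + z n • T)) {q : ℕ}
    (hO : (fun n => Ring.inverse (1 + z n • T)) =O[l] fun n => ‖z n‖ ^ ((q : ℤ) - 1)) :
    Tendsto (fun n => T ^ q * Ring.inverse (1 + z n • T)) l (nhds 0) := by
  have h1 : (fun n => (-z n) ^ q • (T ^ q * Ring.inverse (1 + z n • T))) =O[l]
      fun n => ‖z n‖ ^ ((q : ℤ) - 1) := by
    refine (hO.sub (isBigO_geom_sum hz T q)).congr' (hu.mono fun n hn => ?_) EventuallyEq.rfl
    have h2 : (∑ j ∈ Finset.range q, (-(z n • T)) ^ j) * (1 + z n • T) = 1 - (-(z n • T)) ^ q := by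
      rw [← geom_sum_mul_neg, sub_neg_eq_add]
    have h3 : (-(z n • T)) ^ q = 1 - (∑ j ∈ Finset.range q, (-(z n • T)) ^ j) * (1 + z n • T) := by
      rw [h2]; abel
    change _ = (-z n) ^ q • (T ^ q * Ring.inverse (1 + z n • T))
    rw [← smul_mul_assoc, ← smul_pow, neg_smul, h3, sub_mul, one_mul,
      Ring.mul_inverse_cancel_right _ _ hn]
  have h4 : (fun n => T ^ q * Ring.inverse (1 + z n • T)) =O[l] fun n => ‖z n‖ ^ (-1 : ℤ) := by
    have h5 : (fun n => ((-z n) ^ q)⁻¹) =O[l] fun n => ‖z n‖ ^ (-(q : ℤ)) := by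
      refine IsBigO.of_bound 1 (Eventually.of_forall fun n => ?_)
      simp
    refine (h5.smul h1).congr' ?_ ?_
    · filter_upwards [hz.eventually_gt_atTop 0] with n hn
      rw [smul_smul, inv_mul_cancel₀ (pow_ne_zero _ (neg_ne_zero.2 (norm_pos_iff.1 hn))), one_smul]
    · filter_upwards [hz.eventually_gt_atTop 0] with n hn
      rw [smul_eq_mul, ← zpow_add₀ hn.ne']
      congr 1; ring
  refine h4.trans_tendsto ?_
  simpa [Function.comp_def] using tendsto_inv_atTop_zero.comp hz

/-- If `T^(q+1) x = 0`, then `1 + zT` fixes `T^q x`, so `T^q (1 + zT)⁻¹ x` equals `T^q x` and yet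
tends to `0`. -/
theorem ascentLE_of_isBigO {ι : Type*} {l : Filter ι} [l.NeBot] {z : ι → ℂ}
    (hz : Tendsto (fun n => ‖z n‖) l atTop) {T : X →L[ℂ] X}
    (hu : ∀ᶠ n in l, IsUnit (1 + z n • T)) {q : ℕ}
    (hO : (fun n => Ring.inverse (1 + z n • T)) =O[l] fun n => ‖z n‖ ^ ((q : ℤ) - 1)) :
    AscentLE T q := by
  intro x hx
  have h1 := ((ContinuousLinearMap.apply ℂ X x).continuous.tendsto 0).comp
    (tendsto_pow_mul_inverse hz hu hO)
  have h2 : ∀ᶠ n in l, (T ^ q * Ring.inverse (1 + z n • T)) x = (T ^ q) x := by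
    filter_upwards [hu] with n hn
    have hc : Commute (T ^ q) (Ring.inverse (1 + z n • T)) :=
      commute_ringInverse_right ((Commute.one_right _).add_right
        (((Commute.refl T).pow_left q).smul_right _))
    have h3 : (1 + z n • T) ((T ^ q) x) = (T ^ q) x := by
      have : T ((T ^ q) x) = 0 := by rw [← hx, pow_succ']; rfl
      change (T ^ q) x + z n • T ((T ^ q) x) = _
      rw [this, smul_zero, add_zero]
    rw [hc.eq]
    change Ring.inverse (1 + z n • T) ((T ^ q) x) = _
    conv_lhs => rw [← h3]
    exact DFunLike.congr_fun (Ring.inverse_mul_cancel _ hn) ((T ^ q) x)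
  refine tendsto_nhds_unique (tendsto_const_nhds.congr' (h2.mono fun n hn => hn.symm))
    (h1.trans (by simp))

/-- A continuous linear map close to a surjective one is surjective. -/
theorem exists_pos_forall_norm_sub_lt_surjective {F G : Type*} [NormedAddCommGroup F]
    [NormedSpace ℂ F] [CompleteSpace F] [NormedAddCommGroup G] [NormedSpace ℂ G] [CompleteSpace G]
    (f : F →L[ℂ] G) (hf : Function.Surjective f) :
    ∃ δ > 0, ∀ g : F →L[ℂ] G, ‖g - f‖ < δ → Function.Surjective g := by
  obtain ⟨r, hr⟩ := f.exists_nonlinearRightInverse_of_surjective (LinearMap.range_eq_top.2 hf)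
  have hr' : (0 : ℝ) < (r.nnnorm : ℝ)⁻¹ := by positivity
  refine ⟨(r.nnnorm : ℝ)⁻¹, hr', fun g hg y => ?_⟩
  have happ : ApproximatesLinearOn g f Set.univ ‖g - f‖₊ := by
    intro u _ v _
    have := (g - f).le_opNorm (u - v)
    rw [map_sub] at this
    simp only [sub_apply] at this
    rw [coe_nnnorm, map_sub, show g u - g v - (f u - f v) = g u - f u - (g v - f v) by abel]
    exact this
  have hpos : 0 < (r.nnnorm : ℝ)⁻¹ - ‖g - f‖ := by linarith
  -- The radius is chosen so that the image of the ball covers the ball of radius `‖y‖` about `g 0 =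
  -- 0`.
  obtain ⟨x, -, hx⟩ := happ.surjOn_closedBall_of_nonlinearRightInverse r (b := 0)
    (ε := ‖y‖ / ((r.nnnorm : ℝ)⁻¹ - ‖g - f‖)) (by positivity) (Set.subset_univ _)
    (show y ∈ _ by
      rw [coe_nnnorm, mul_div_cancel₀ _ hpos.ne']
      simp)
  exact ⟨x, hx⟩

/-- `T^q` maps onto the Banach space `ran T^q`. Its perturbation `T^q (zT)(1 + zT)⁻¹ = T^q - T^q (1
+ zT)⁻¹` is close to it for suitable `z`, hence still onto, and has range inside `ran T^(q+1)`. -/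
theorem descentLE_of_isBigO_of_isClosed [CompleteSpace X] {ι : Type*} {l : Filter ι} [l.NeBot]
    {z : ι → ℂ} (hz : Tendsto (fun n => ‖z n‖) l atTop) {T : X →L[ℂ] X}
    (hu : ∀ᶠ n in l, IsUnit (1 + z n • T)) {q : ℕ}
    (hO : (fun n => Ring.inverse (1 + z n • T)) =O[l] fun n => ‖z n‖ ^ ((q : ℤ) - 1))
    (hcl : IsClosed (Set.range (T ^ q))) : DescentLE T q := by
  let Y : Submodule ℂ X := LinearMap.range ((T ^ q : X →L[ℂ] X) : X →ₗ[ℂ] X)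
  have hY : IsClosed (Y : Set X) := by
    rw [LinearMap.coe_range]; exact hcl
  have : CompleteSpace Y := hY.completeSpace_coe
  let π : X →L[ℂ] Y := (T ^ q).codRestrict Y fun x => ⟨x, rfl⟩
  have hπ : Function.Surjective π := by
    rintro ⟨_, x, rfl⟩
    exact ⟨x, rfl⟩
  obtain ⟨δ, hδ, h⟩ := exists_pos_forall_norm_sub_lt_surjective π hπ
  have hlim := tendsto_pow_mul_inverse hz hu hO
  obtain ⟨n, hn, hnu⟩ := ((hlim.norm.eventually_lt_const (by simpa using hδ)).and hu).exists
  have hsurj : Function.Surjective (π.comp (z n • T * Ring.inverse (1 + z n • T))) := by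
    refine h _ (lt_of_le_of_lt ?_ hn)
    refine ContinuousLinearMap.opNorm_le_bound _ (norm_nonneg _) fun x => ?_
    have h1 : z n • T * Ring.inverse (1 + z n • T) - 1 = - Ring.inverse (1 + z n • T) := by
      have := Ring.mul_inverse_cancel _ hnu
      rw [add_mul, one_mul] at this
      nth_rewrite 2 [← this]
      abel
    have h2 : (π.comp (z n • T * Ring.inverse (1 + z n • T)) - π) x =
        π (-(Ring.inverse (1 + z n • T) x)) := by
      have := DFunLike.congr_fun h1 x
      change π ((z n • T * Ring.inverse (1 + z n • T)) x) - π x = _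
      rw [← map_sub]
      exact congrArg π this
    rw [h2, map_neg, norm_neg]
    exact (T ^ q * Ring.inverse (1 + z n • T)).le_opNorm x
  intro x
  obtain ⟨y, hy⟩ := hsurj (π x)
  refine ⟨z n • Ring.inverse (1 + z n • T) y, ?_⟩
  have h3 : (T ^ q) ((z n • T * Ring.inverse (1 + z n • T)) y) = (T ^ q) x :=
    congrArg Subtype.val hy
  rw [← h3, pow_succ, map_smul, smul_mul_assoc, smul_apply, map_smul]
  rfl

/-- Let `T^(k+1) x = 0` and let `g` solve `T^(k+1) (g x) = T^k x` with `‖g x‖ ≤ C‖x‖`. For `w =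
-1/z` small, `v = ∑ w^i g^(i+1) x` makes `T (T^k (x + wv)) = w T^k (x + wv)`. Injectivity of `1 +
zT` forces `T^k x = -w T^k v`, and `v` stays bounded as `w → 0`. -/
theorem ascentLE_of_descentLE_of_isUnit [CompleteSpace X] {ι : Type*} {l : Filter ι} [l.NeBot]
    {z : ι → ℂ} (hz : Tendsto (fun n => ‖z n‖) l atTop) {T : X →L[ℂ] X}
    (hu : ∀ᶠ n in l, IsUnit (1 + z n • T)) {k : ℕ} (hd : DescentLE T k) : AscentLE T k := by
  intro x hx
  obtain ⟨C, hC, g, hg⟩ := exists_lift_norm_le (T ^ k) (T ^ (k + 1)) hd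
  have hbound : ∀ n, ‖g^[n] x‖ ≤ C ^ n * ‖x‖ := by
    intro n
    induction n with
    | zero => simp
    | succ n ih =>
      rw [Function.iterate_succ_apply', pow_succ', mul_assoc]
      exact (hg _).2.trans (by gcongr)
  have hw : Tendsto (fun n => -(z n)⁻¹) l (nhds 0) := by
    have := (tendsto_inv₀_cobounded.comp (tendsto_norm_atTop_iff_cobounded.1 hz)).neg
    simpa [Function.comp_def] using this
  -- This threshold gives `|w| C ≤ 1/2`, so one geometric series bounds `v` uniformly in `n`.
  have hsmall : ∀ᶠ n in l, ‖-(z n)⁻¹‖ < (2 * C)⁻¹ :=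
    hw.norm.eventually_lt_const (by rw [norm_zero]; positivity)
  have hest : ∀ᶠ n in l, ‖(T ^ k) x‖ ≤ ‖-(z n)⁻¹‖ * (‖T ^ k‖ * (2 * (C * ‖x‖))) := by
    filter_upwards [hu, hsmall, hz.eventually_gt_atTop 0] with n hn hn2 hn0
    set w : ℂ := -(z n)⁻¹ with hw_def
    have hzw : z n * w = -1 := by
      rw [hw_def, mul_neg, mul_inv_cancel₀ (norm_pos_iff.1 hn0)]
    have hwC : ‖w‖ * C ≤ 1 / 2 := by
      have : ‖w‖ * C ≤ (2 * C)⁻¹ * C := by gcongr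
      refine this.trans (le_of_eq ?_)
      field_simp
    have hterm : ∀ i : ℕ, ‖w ^ i • g^[i + 1] x‖ ≤ C * ‖x‖ * (1 / 2) ^ i := by
      intro i
      rw [norm_smul, norm_pow]
      calc ‖w‖ ^ i * ‖g^[i + 1] x‖ ≤ ‖w‖ ^ i * (C ^ (i + 1) * ‖x‖) := by
            gcongr; exact hbound _
        _ = C * ‖x‖ * (‖w‖ * C) ^ i := by ring
        _ ≤ _ := by gcongr
    have hgeo : HasSum (fun i : ℕ => C * ‖x‖ * (1 / 2 : ℝ) ^ i) (C * ‖x‖ * 2) :=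
      hasSum_geometric_two.mul_left _
    have hsum : Summable fun i : ℕ => w ^ i • g^[i + 1] x :=
      Summable.of_norm_bounded hgeo.summable hterm
    set v := ∑' i : ℕ, w ^ i • g^[i + 1] x with hv
    have hvnorm : ‖v‖ ≤ C * ‖x‖ * 2 := tsum_of_norm_bounded hgeo hterm
    have hTv : (T ^ (k + 1)) v = (T ^ k) (x + w • v) := by
      have h1 : HasSum (fun i : ℕ => w ^ i • (T ^ k) (g^[i] x)) ((T ^ (k + 1)) v) := by
        have := hsum.hasSum.mapL (T ^ (k + 1))
        refine this.congr_fun fun i => ?_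
        rw [map_smul, Function.iterate_succ_apply', (hg _).1]
      have h2 : HasSum (fun i : ℕ => w ^ (i + 1) • (T ^ k) (g^[i + 1] x)) (w • (T ^ k) v) := by
        have := (hsum.hasSum.mapL (T ^ k)).const_smul w
        refine this.congr_fun fun i => ?_
        rw [map_smul, smul_smul, pow_succ']
      have h3 := (hasSum_nat_add_iff' (f := fun i : ℕ => w ^ i • (T ^ k) (g^[i] x)) 1).2 h1
      have h4 := h3.unique h2
      rw [Finset.sum_range_one, pow_zero, one_smul, Function.iterate_zero, id,
        sub_eq_iff_eq_add'] at h4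
      rw [h4, map_add, map_smul]
    have hker : (T ^ k) (x + w • v) = 0 := by
      obtain ⟨u, hu'⟩ := hn
      have hinj : Function.Injective (1 + z n • T : X →L[ℂ] X) := by
        rw [← hu']; exact (ContinuousLinearEquiv.ofUnit u).injective
      refine (injective_iff_map_eq_zero _).1 hinj _ ?_
      have h5 : T ((T ^ k) (x + w • v)) = w • (T ^ k) (x + w • v) := by
        have : T ((T ^ k) (x + w • v)) = (T ^ (k + 1)) (x + w • v) := by rw [pow_succ']; rfl
        rw [this, map_add, hx, zero_add, map_smul, hTv]
      change (T ^ k) (x + w • v) + z n • T ((T ^ k) (x + w • v)) = 0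
      rw [h5, smul_smul, hzw, neg_one_smul, add_neg_cancel]
    rw [map_add, map_smul, add_eq_zero_iff_eq_neg] at hker
    rw [hker, norm_neg, norm_smul]
    gcongr
    refine (T ^ k).le_opNorm_of_le (hvnorm.trans (le_of_eq ?_))
    ring
  have hlim : Tendsto (fun n => ‖-(z n)⁻¹‖ * (‖T ^ k‖ * (2 * (C * ‖x‖)))) l (nhds 0) := by
    simpa using hw.norm.mul_const (‖T ^ k‖ * (2 * (C * ‖x‖)))
  exact norm_le_zero_iff.1 (ge_of_tendsto hlim hest)

/-! ### A pole of the resolvent gives finite ascent and descent -/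

/-- Division of an analytic solution of `(z + T) G(z) = z ^ m` by successive powers of `z`. -/
theorem exists_analyticAt_remainder {R : Type*} [NormedRing R] [NormedAlgebra ℂ R]
    {T : R} {m : ℕ} {F : ℂ → R} (hF : AnalyticAt ℂ F 0)
    (heq : ∀ᶠ z in nhdsWithin (0 : ℂ) {0}ᶜ, (z • 1 + T) * F z = z ^ m • 1 ∧ Commute T (F z))
    (j : ℕ) (hj : j ≤ m) :
    ∃ (G : ℂ → R) (B : R), AnalyticAt ℂ G 0 ∧ T ^ j * B = 0 ∧
      ∀ᶠ z in nhdsWithin (0 : ℂ) {0}ᶜ,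
        (z • 1 + T) * G z = z ^ (m - j) • 1 + B ∧ Commute T (G z) := by
  induction j with
  | zero => exact ⟨F, 0, hF, by simp, by simpa using heq⟩
  | succ j ih =>
    obtain ⟨G, B, hG, hB, hGB⟩ := ih (by omega)
    have hne : ∀ᶠ z in nhdsWithin (0 : ℂ) {0}ᶜ, z ≠ 0 := eventually_mem_nhdsWithin
    have hcont : Tendsto G (nhdsWithin 0 {0}ᶜ) (nhds (G 0)) :=
      hG.continuousAt.tendsto.mono_left nhdsWithin_le_nhds
    have hid : Tendsto (fun z : ℂ => z) (nhdsWithin 0 {0}ᶜ) (nhds 0) :=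
      tendsto_id.mono_left nhdsWithin_le_nhds
    -- Since `m - j > 0`, letting `z → 0` leaves only `B`. Dividing `G - G 0` by `z` then produces
    -- the remainder `-G 0`, which `T^(j+1)` kills because `T^j B = 0`.
    have hT0 : T * G 0 = B := by
      have h1 : Tendsto (fun z : ℂ => (z • (1 : R) + T) * G z) (nhdsWithin 0 {0}ᶜ)
          (nhds (((0 : ℂ) • (1 : R) + T) * G 0)) := ((hid.smul_const _).add_const T).mul hcont
      have h2 : Tendsto (fun z : ℂ => z ^ (m - j) • (1 : R) + B) (nhdsWithin 0 {0}ᶜ)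
          (nhds ((0 : ℂ) ^ (m - j) • (1 : R) + B)) := ((hid.pow _).smul_const _).add_const B
      have := tendsto_nhds_unique (h1.congr' (hGB.mono fun z hz => hz.1)) h2
      simpa [zero_pow (show m - j ≠ 0 by omega)] using this
    have hc0 : Commute T (G 0) :=
      tendsto_nhds_unique ((tendsto_const_nhds.mul hcont).congr' (hGB.mono fun z hz => hz.2.eq))
        (hcont.mul_const T)
    obtain ⟨p, hp⟩ := hG
    refine ⟨dslope G 0, -G 0, hp.has_fpower_series_dslope_fslope.analyticAt, ?_, ?_⟩
    · rw [pow_succ, mul_neg, mul_assoc, hT0, hB, neg_zero]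
    · filter_upwards [hGB, hne] with z hz hz0
      have hds : dslope G 0 z = z⁻¹ • (G z - G 0) := by
        rw [dslope_of_ne _ hz0, slope_def_module, sub_zero]
      rw [hds]
      refine ⟨?_, (hz.2.sub_right hc0).smul_right _⟩
      have h3 : (z • 1 + T) * (G z - G 0) = z • (z ^ (m - (j + 1)) • (1 : R) + -G 0) := by
        have h4 : z ^ (m - j) = z * z ^ (m - (j + 1)) := by
          rw [← pow_succ']; congr 1; omega
        rw [mul_sub, hz.1, add_mul, hT0, smul_mul_assoc, one_mul, h4, smul_add, smul_smul,
          smul_neg]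
        abel
      rw [mul_smul_comm, h3, smul_smul, inv_mul_cancel₀ hz0, one_smul]

/-- Under `z ↦ 1/z` the bound says that `z^m (z + T)⁻¹` is bounded near `0`, so its singularity is
removable. Dividing `m` times by `z` gives `T G(0) = 1 + B` with `T^m B = 0`. Hence `T^(m+1) G(0) =
T^m` with `G(0)` commuting with `T`, which yields descent and ascent together. -/
theorem ascentLE_and_descentLE_of_isBigO_cobounded [CompleteSpace X] {T : X →L[ℂ] X} {m : ℕ}
    (hu : ∀ᶠ z in cobounded ℂ, IsUnit (1 + z • T))
    (hO : (fun z : ℂ => Ring.inverse (1 + z • T)) =O[cobounded ℂ] fun z => ‖z‖ ^ ((m : ℤ) - 1)) :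
    AscentLE T m ∧ DescentLE T m := by
  set l : Filter ℂ := nhdsWithin 0 {0}ᶜ with hl
  have hne : ∀ᶠ z in l, z ≠ 0 := eventually_mem_nhdsWithin
  have hinv : Tendsto (fun z : ℂ => z⁻¹) l (cobounded ℂ) := tendsto_inv₀_nhdsNE_zero
  have hfac : ∀ z : ℂ, z ≠ 0 → z • 1 + T = z • (1 + z⁻¹ • T) := by
    intro z hz
    rw [smul_add, smul_smul, mul_inv_cancel₀ hz, one_smul]
  have hunit : ∀ᶠ z in l, IsUnit (z • 1 + T) := by
    filter_upwards [hinv.eventually hu, hne] with z hz hz0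
    rw [hfac z hz0]
    exact hz.smul (Units.mk0 z hz0)
  set F : ℂ → X →L[ℂ] X := fun z => z ^ m • Ring.inverse (z • 1 + T) with hF
  have hdiff : ∀ᶠ z in l, DifferentiableAt ℂ F z := by
    filter_upwards [hunit] with z hz
    have h1 : DifferentiableAt ℂ (fun z : ℂ => z • (1 : X →L[ℂ] X) + T) z :=
      (differentiableAt_id.smul_const (1 : X →L[ℂ] X)).add_const T
    exact (differentiableAt_id.pow m).smul (h1.inverse hz)
  have hbd : F =O[l] fun _ => (1 : ℝ) := by
    have h1 := (hO.comp_tendsto hinv)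
    have h2 : (fun z : ℂ => z ^ ((m : ℤ) - 1)) =O[l] fun z => ‖z‖ ^ ((m : ℤ) - 1) :=
      IsBigO.of_bound 1 (Eventually.of_forall fun z => by simp)
    refine (h2.smul h1).congr' ?_ ?_
    · filter_upwards [hinv.eventually hu, hne] with z hz hz0
      have h3 : Ring.inverse (z • 1 + T) = z⁻¹ • Ring.inverse (1 + z⁻¹ • T) := by
        have hzu : IsUnit (z • 1 + T) := by
          rw [hfac z hz0]; exact hz.smul (Units.mk0 z hz0)
        have h4 : (z • 1 + T) * (z⁻¹ • Ring.inverse (1 + z⁻¹ • T)) = 1 := by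
          rw [hfac z hz0, smul_mul_smul_comm, mul_inv_cancel₀ hz0, Ring.mul_inverse_cancel _ hz,
            one_smul]
        have := Ring.inverse_mul_cancel_left (z • 1 + T) (z⁻¹ • Ring.inverse (1 + z⁻¹ • T)) hzu
        rw [← this, h4, mul_one]
      simp only [hF, h3, Function.comp_apply]
      rw [smul_smul, zpow_sub_one₀ hz0, zpow_natCast]
    · filter_upwards [hne] with z hz0
      have : ‖z‖ ≠ 0 := norm_ne_zero_iff.2 hz0
      simp only [Function.comp_apply, norm_inv, inv_zpow, smul_eq_mul]
      exact mul_inv_cancel₀ (zpow_ne_zero _ this)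
  have hlim : Tendsto F l (nhds (limUnder l F)) := by
    refine Complex.tendsto_limUnder_of_differentiable_on_punctured_nhds_of_bounded_under hdiff ?_
    have : (fun z => F z - F 0) =O[l] fun _ => (1 : ℝ) :=
      hbd.sub (isBigO_const_const _ one_ne_zero _)
    exact (isBigO_one_iff ℝ).1 this
  set F' := Function.update F 0 (limUnder l F) with hF'
  have hF'eq : ∀ᶠ z in l, F' z = F z := hne.mono fun z hz => Function.update_of_ne hz _ _
  have han : AnalyticAt ℂ F' 0 := by
    refine Complex.analyticAt_of_differentiable_on_punctured_nhds_of_continuousAt ?_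
      (continuousAt_update_same.2 hlim)
    filter_upwards [hdiff, hne] with z hz hz0
    refine hz.congr_of_eventuallyEq ?_
    filter_upwards [isOpen_ne.mem_nhds hz0] with y hy
    exact Function.update_of_ne hy _ _
  have heq : ∀ᶠ z in l, (z • 1 + T) * F' z = z ^ m • 1 ∧ Commute T (F' z) := by
    filter_upwards [hunit, hF'eq] with z hz hzF
    rw [hzF]
    refine ⟨?_, (commute_ringInverse_right (((Commute.one_right T).smul_right _).add_right
      (Commute.refl T))).smul_right _⟩
    rw [hF, mul_smul_comm, Ring.mul_inverse_cancel _ hz]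
  obtain ⟨G, B, hG, hB, hGB⟩ := exists_analyticAt_remainder han heq m le_rfl
  have hcont : Tendsto G l (nhds (G 0)) := hG.continuousAt.tendsto.mono_left nhdsWithin_le_nhds
  have hid : Tendsto (fun z : ℂ => z) l (nhds 0) := tendsto_id.mono_left nhdsWithin_le_nhds
  have hT0 : T * G 0 = 1 + B := by
    have h1 : Tendsto (fun z : ℂ => (z • 1 + T) * G z) l (nhds (((0 : ℂ) • 1 + T) * G 0)) :=
      ((hid.smul_const _).add_const T).mul hcont
    have h2 : Tendsto (fun z : ℂ => z ^ (m - m) • (1 : X →L[ℂ] X) + B) l (nhds (1 + B)) := by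
      simp only [Nat.sub_self, pow_zero, one_smul]
      exact tendsto_const_nhds
    have := tendsto_nhds_unique (h1.congr' (hGB.mono fun z hz => hz.1)) h2
    simpa using this
  have hc0 : Commute T (G 0) :=
    tendsto_nhds_unique ((tendsto_const_nhds.mul hcont).congr' (hGB.mono fun z hz => hz.2.eq))
      (hcont.mul_const T)
  have hfin : T ^ (m + 1) * G 0 = T ^ m := by
    rw [pow_succ, mul_assoc, hT0, mul_add, mul_one, hB, add_zero]
  refine ⟨fun x hx => ?_, fun x => ⟨G 0 x, DFunLike.congr_fun hfin x⟩⟩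
  rw [← hfin, (hc0.pow_left (m + 1)).eq]
  change G 0 ((T ^ (m + 1)) x) = 0
  rw [hx, map_zero]

/-! ### Reduction of a regular pencil to a single operator -/

/-- Every regular pencil is of the form `(B T, B (μ T - 1))` with `B` invertible. -/
theorem exists_eq_mul_of_isRegular [CompleteSpace X] {E A : X →L[ℂ] X} (h : IsRegular E A) :
    ∃ (B T : X →L[ℂ] X) (μ : ℂ), IsUnit B ∧ E = B * T ∧ A = B * (μ • T - 1) := by
  obtain ⟨μ, hμ⟩ := h
  have hB : IsUnit (μ • E - A) := ContinuousLinearMap.isUnit_iff_bijective.2 hμ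
  have h1 := Ring.mul_inverse_cancel_left _ E hB
  refine ⟨μ • E - A, Ring.inverse (μ • E - A) * E, μ, hB, h1.symm, ?_⟩
  rw [mul_sub, mul_smul_comm, h1, mul_one, sub_sub_cancel]

theorem smul_mul_sub_mul (B T : X →L[ℂ] X) (μ s : ℂ) :
    s • (B * T) - B * (μ • T - 1) = B * (1 + (s - μ) • T) := by
  rw [mul_sub, mul_add, mul_smul_comm, mul_smul_comm, sub_smul, mul_one]
  abel

theorem mem_pencilResolventSet_iff [CompleteSpace X] {B : X →L[ℂ] X} (hB : IsUnit B)
    (T : X →L[ℂ] X) (μ s : ℂ) :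
    s ∈ pencilResolventSet (B * T) (B * (μ • T - 1)) ↔ IsUnit (1 + (s - μ) • T) := by
  obtain ⟨u, rfl⟩ := hB
  rw [← Units.isUnit_units_mul u, ← smul_mul_sub_mul, ContinuousLinearMap.isUnit_iff_bijective]
  rfl

theorem pencilResolvent_mul [CompleteSpace X] (u : (X →L[ℂ] X)ˣ) (T : X →L[ℂ] X) (μ s : ℂ) :
    pencilResolvent ((u : X →L[ℂ] X) * T) ((u : X →L[ℂ] X) * (μ • T - 1)) s =
      Ring.inverse (1 + (s - μ) • T) * ((u⁻¹ : (X →L[ℂ] X)ˣ) : X →L[ℂ] X) := by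
  rw [pencilResolvent, smul_mul_sub_mul]
  by_cases h : IsUnit (1 + (s - μ) • T)
  · obtain ⟨v, hv⟩ := h
    rw [← hv, ← Units.val_mul, Ring.inverse_unit, Ring.inverse_unit, mul_inv_rev, Units.val_mul]
  · rw [Ring.inverse_non_unit _ h, Ring.inverse_non_unit, zero_mul]
    rwa [Units.isUnit_units_mul]

/-- The factor `B⁻¹` and the shift by `μ` change only constants, as `|s|` and `|s - μ|` are
comparable at infinity. -/
theorem isBigO_pencilResolvent_iff [CompleteSpace X] {B : X →L[ℂ] X} (hB : IsUnit B)
    (T : X →L[ℂ] X) (μ : ℂ) {ι : Type*} {l : Filter ι} {s : ι → ℂ}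
    (hs : Tendsto (fun n => ‖s n‖) l atTop) (p : ℤ) :
    (fun n => ‖pencilResolvent (B * T) (B * (μ • T - 1)) (s n)‖) =O[l] (fun n => ‖s n‖ ^ p) ↔
      (fun n => Ring.inverse (1 + (s n - μ) • T)) =O[l] fun n => ‖s n - μ‖ ^ p := by
  obtain ⟨u, rfl⟩ := hB
  have hΘ : (fun n => ‖s n‖ ^ p) =Θ[l] fun n => ‖s n - μ‖ ^ p := by
    have h1 : (fun n => s n) =Θ[l] fun n => s n - μ := by
      have h2 : (fun _ : ι => μ) =o[l] s :=
        (isLittleO_const_left.2 (Or.inr hs))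
      exact ((IsEquivalent.refl (u := s)).sub_isLittleO h2).isTheta.symm
    exact h1.norm_left.norm_right.zpow p
  rw [isBigO_norm_left, hΘ.isBigO_congr_right]
  simp only [pencilResolvent_mul]
  have hconst : ∀ b : X →L[ℂ] X, (fun _ : ι => b) =O[l] fun _ => (1 : ℝ) := fun b =>
    isBigO_const_const b one_ne_zero l
  constructor
  · intro h
    have := h.mul (hconst u)
    simpa [mul_assoc] using this
  · intro h
    have := h.mul (hconst ((u⁻¹ : (X →L[ℂ] X)ˣ) : X →L[ℂ] X))
    simpa using this

theorem isBounded_pencilSpectrum_iff [CompleteSpace X] {B : X →L[ℂ] X} (hB : IsUnit B)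
    (T : X →L[ℂ] X) (μ : ℂ) :
    IsBounded (pencilSpectrum (B * T) (B * (μ • T - 1))) ↔
      ∀ᶠ z in cobounded ℂ, IsUnit (1 + z • T) := by
  rw [isBounded_def, pencilSpectrum, compl_compl]
  have h1 : pencilResolventSet (B * T) (B * (μ • T - 1)) ∈ cobounded ℂ ↔
      ∀ᶠ s in cobounded ℂ, IsUnit (1 + (s - μ) • T) :=
    eventually_congr (Eventually.of_forall fun s => mem_pencilResolventSet_iff hB T μ s)
  rw [h1]
  constructor
  · intro h
    simpa using (tendsto_add_const_cobounded μ).eventually h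
  · exact fun h => (tendsto_sub_const_cobounded μ).eventually h

theorem tendsto_norm_sub_const {ι : Type*} {l : Filter ι} {s : ι → ℂ}
    (hs : Tendsto (fun n => ‖s n‖) l atTop) (μ : ℂ) :
    Tendsto (fun n => ‖s n - μ‖) l atTop := by
  rw [tendsto_norm_atTop_iff_cobounded] at hs ⊢
  exact (tendsto_sub_const_cobounded μ).comp hs

/-! ### Minimality of the index -/

/-- The positive exponents from which on both the ranges and the kernels of the powers of `T` are
stationary. -/
def stationaryExponents (T : X →L[ℂ] X) : Set ℕ :=
  {k | 1 ≤ k ∧ DescentLE T k ∧ AscentLE T k}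

theorem isLeast_stationaryExponents_of_not_isBigO [CompleteSpace X] {T : X →L[ℂ] X} {m : ℕ}
    (hm : m ∈ stationaryExponents T) {ι : Type*} {l : Filter ι} {z : ι → ℂ}
    (hz : Tendsto (fun n => ‖z n‖) l atTop)
    (hO : ¬ (fun n => Ring.inverse (1 + z n • T)) =O[l] fun n => ‖z n‖ ^ ((m : ℤ) - 2)) :
    IsLeast (stationaryExponents T) m := by
  refine ⟨hm, fun k hk => ?_⟩
  by_contra hlt
  have h1 := (eventually_isUnit_and_isBigO_inverse hk.1 hk.2.2 hk.2.1).2.comp_tendsto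
    (tendsto_norm_atTop_iff_cobounded.1 hz)
  exact hO (h1.trans (isBigO_zpow_of_le hz (by omega)))

/-- The bound would lower the ascent, and with it the descent, to `m - 1`. For `m ≥ 2` this
contradicts minimality; for `m = 1` it makes `T` bijective. -/
theorem not_isBigO_of_isLeast_stationaryExponents [CompleteSpace X] {T : X →L[ℂ] X}
    (hT : ¬ IsUnit T) {m : ℕ} (hm : IsLeast (stationaryExponents T) m) {ι : Type*} {l : Filter ι}
    [l.NeBot] {z : ι → ℂ} (hz : Tendsto (fun n => ‖z n‖) l atTop)
    (hu : ∀ᶠ n in l, IsUnit (1 + z n • T)) :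
    ¬ (fun n => Ring.inverse (1 + z n • T)) =O[l] fun n => ‖z n‖ ^ ((m : ℤ) - 2) := by
  obtain ⟨q, rfl⟩ := Nat.exists_eq_add_of_le' hm.1.1
  intro hO
  have ha : AscentLE T q := by
    refine ascentLE_of_isBigO hz hu (hO.trans_eventuallyEq (Eventually.of_forall fun n => ?_))
    change ‖z n‖ ^ (((q + 1 : ℕ) : ℤ) - 2) = _
    congr 1; push_cast; ring
  have hd : DescentLE T q := hm.1.2.1.of_ascentLE ha
  rcases Nat.eq_zero_or_pos q with rfl | hq
  · exact hT (isUnit_of_ascentLE_zero_of_descentLE_zero ha hd)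
  · have := hm.2 ⟨hq, hd, ha⟩
    omega

/-- With a Drazin inverse `S`, `ran T^k` is the range of the idempotent `TS`, that is, its fixed
space. -/
theorem isClosed_range_pow [CompleteSpace X] {T : X →L[ℂ] X} {k : ℕ} (ha : AscentLE T k)
    (hd : DescentLE T k) : IsClosed (Set.range (T ^ k)) := by
  obtain ⟨S, hc, hS, hk⟩ := exists_drazin_inverse ha hd
  have h1 : Set.range (T ^ k) = {x | (T * S) x = x} := by
    have hQ : T * S * T ^ k = T ^ k := by
      rw [mul_assoc, (hc.symm.pow_right k).eq, ← mul_assoc, ← pow_succ', hk]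
    have hpow : ∀ j, T * S = T ^ j * (S ^ j * (T * S)) := by
      intro j
      induction j with
      | zero => simp
      | succ j ih =>
        have h2 : T * S * (T * S) = T * S := by
          rw [mul_assoc, ← mul_assoc S T S, hS]
        have h3 : Commute T (S ^ j) := hc.pow_right j
        calc T * S = T ^ j * (S ^ j * (T * S * (T * S))) := by rw [h2]; exact ih
          _ = T ^ j * ((S ^ j * T) * (S * (T * S))) := by simp only [mul_assoc]
          _ = T ^ (j + 1) * (S ^ (j + 1) * (T * S)) := by
            rw [← h3.eq, pow_succ, pow_succ]; simp only [mul_assoc]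
    ext x
    constructor
    · rintro ⟨y, rfl⟩
      exact DFunLike.congr_fun hQ y
    · intro hx
      exact ⟨(S ^ k * (T * S)) x, (DFunLike.congr_fun (hpow k) x).symm.trans hx⟩
  rw [h1]
  exact isClosed_eq (T * S).continuous continuous_id

end OperatorPencil

/-! ### The equivalences, all routed through (iv) -/

theorem theorem3 {X : Type*} [NormedAddCommGroup X] [NormedSpace ℂ X] [CompleteSpace X]
    (E A : X →L[ℂ] X) (hE : ¬ IsUnit E) (hreg : OperatorPencil.IsRegular E A)
    (m : ℕ) (hm : 1 ≤ m) :
    List.TFAE [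
      OperatorPencil.HasFiniteIndex E A m,
      Bornology.IsBounded (OperatorPencil.pencilSpectrum E A) ∧
        IsLeast {k : ℕ | 1 ≤ k ∧
          OperatorPencil.wongR E A (k + 1) = OperatorPencil.wongR E A k} m,
      IsLeast {k : ℕ | 1 ≤ k ∧
        IsCompl (OperatorPencil.wongN E A k) (OperatorPencil.wongR E A k)} m,
      IsLeast {k : ℕ | 1 ≤ k ∧
        OperatorPencil.wongR E A (k + 1) = OperatorPencil.wongR E A k ∧
        OperatorPencil.wongN E A (k + 1) = OperatorPencil.wongN E A k} m,
      (∃ s : ℕ → ℂ, OperatorPencil.HasGrowthAlong E A m s) ∧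
        IsClosed (OperatorPencil.wongR E A m : Set X),
      (∃ s : ℕ → ℂ, OperatorPencil.HasGrowthAlong E A m s) ∧
        ∃ k : ℕ, OperatorPencil.wongR E A (k + 1) = OperatorPencil.wongR E A k] := by
  obtain ⟨B, T, μ, hB, rfl, rfl⟩ := OperatorPencil.exists_eq_mul_of_isRegular hreg
  have hT : ¬ IsUnit T := fun h => hE (hB.mul h)
  have hRm : (OperatorPencil.wongR (B * T) (B * (μ • T - 1)) m : Set X) = Set.range (T ^ m) := by
    ext x
    exact OperatorPencil.mem_wongR_iff hB T μ m x
  have hset : {k : ℕ | 1 ≤ k ∧ IsCompl (OperatorPencil.wongN (B * T) (B * (μ • T - 1)) k)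
      (OperatorPencil.wongR (B * T) (B * (μ • T - 1)) k)} =
      OperatorPencil.stationaryExponents T := by
    ext k
    exact and_congr_right fun hk => OperatorPencil.isCompl_wongN_wongR_iff hB T μ hk
  rw [hset, hRm]
  unfold OperatorPencil.HasFiniteIndex OperatorPencil.HasGrowthAlong
  simp only [OperatorPencil.wongR_succ_eq_iff hB, OperatorPencil.wongN_succ_eq_iff hB,
    OperatorPencil.isBounded_pencilSpectrum_iff hB, OperatorPencil.mem_pencilResolventSet_iff hB]
  change List.TFAE [_, _, _, IsLeast (OperatorPencil.stationaryExponents T) m, _, _]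
  have hnorm : Tendsto (fun s : ℂ => ‖s‖) (cobounded ℂ) atTop := tendsto_norm_cobounded_atTop
  have growth : ∀ {s : ℕ → ℂ} (hs : Tendsto (fun n => ‖s n‖) atTop atTop) (p : ℤ), _ :=
    fun hs p => OperatorPencil.isBigO_pencilResolvent_iff hB T μ hs p
  have growth' := fun p => OperatorPencil.isBigO_pencilResolvent_iff hB T μ hnorm p
  have hsub := OperatorPencil.tendsto_norm_sub_const hnorm μ
  tfae_have 3 ↔ 4 := Iff.rfl
  tfae_have 1 → 4 := by
    rintro ⟨hu, hO, hnO⟩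
    rw [growth'] at hO hnO
    have hO' : (fun z : ℂ => Ring.inverse (1 + z • T)) =O[cobounded ℂ]
        fun z => ‖z‖ ^ ((m : ℤ) - 1) := by
      simpa [Function.comp_def] using hO.comp_tendsto (tendsto_add_const_cobounded μ)
    obtain ⟨ha, hd⟩ := OperatorPencil.ascentLE_and_descentLE_of_isBigO_cobounded hu hO'
    exact OperatorPencil.isLeast_stationaryExponents_of_not_isBigO ⟨hm, hd, ha⟩ hsub hnO
  tfae_have 4 → 1 := by
    intro h
    obtain ⟨hu, hO⟩ :=
      OperatorPencil.eventually_isUnit_and_isBigO_inverse hm h.1.2.2 h.1.2.1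
    have hshift := tendsto_sub_const_cobounded μ
    refine ⟨hu, ?_, ?_⟩
    · rw [growth']
      exact hO.comp_tendsto hshift
    · rw [growth']
      exact OperatorPencil.not_isBigO_of_isLeast_stationaryExponents hT h hsub
        (hshift.eventually hu)
  tfae_have 2 → 4 := by
    rintro ⟨hu, h⟩
    have ha := OperatorPencil.ascentLE_of_descentLE_of_isUnit hnorm hu h.1.2
    exact ⟨⟨hm, h.1.2, ha⟩, fun k hk => h.2 ⟨hk.1, hk.2.1⟩⟩
  tfae_have 4 → 2 := by
    intro h
    -- A competitor `k` in (ii) has only descent; finite ascent of `T` supplies ascent at the same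
    -- `k`.
    refine ⟨(OperatorPencil.eventually_isUnit_and_isBigO_inverse hm h.1.2.2 h.1.2.1).1,
      ⟨hm, h.1.2.1⟩, fun k hk => h.2 ⟨hk.1, hk.2, h.1.2.2.of_descentLE hk.2⟩⟩
  have hseq : IsLeast (OperatorPencil.stationaryExponents T) m →
      ∃ s : ℕ → ℂ, (∀ n, IsUnit (1 + (s n - μ) • T)) ∧ Tendsto (fun n => ‖s n‖) atTop atTop ∧
        (fun n => ‖OperatorPencil.pencilResolvent (B * T) (B * (μ • T - 1)) (s n)‖) =O[atTop]
          (fun n => ‖s n‖ ^ ((m : ℤ) - 1)) ∧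
        ¬ (fun n => ‖OperatorPencil.pencilResolvent (B * T) (B * (μ • T - 1)) (s n)‖) =O[atTop]
          (fun n => ‖s n‖ ^ ((m : ℤ) - 2)) := by
    intro h
    obtain ⟨hu, hO⟩ :=
      OperatorPencil.eventually_isUnit_and_isBigO_inverse hm h.1.2.2 h.1.2.1
    have hev := (tendsto_sub_const_cobounded μ).eventually hu
    -- Outside radius `r` the resolvent exists; the real points `max r 0 + n` avoid that disc and
    -- equal their own norms.
    obtain ⟨r, -, hr⟩ := (hasBasis_cobounded_norm (E := ℂ)).eventually_iff.1 hev
    have hnormeq : ∀ n : ℕ, ‖((max r 0 + n : ℝ) : ℂ)‖ = max r 0 + n := fun n => by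
      rw [Complex.norm_real, Real.norm_of_nonneg (by positivity)]
    have hs : Tendsto (fun n : ℕ => ‖((max r 0 + n : ℝ) : ℂ)‖) atTop atTop := by
      simp only [hnormeq]
      exact tendsto_atTop_add_const_left _ _ tendsto_natCast_atTop_atTop
    have hmem : ∀ n : ℕ, IsUnit (1 + (((max r 0 + n : ℝ) : ℂ) - μ) • T) := fun n => by
      apply hr
      change r ≤ ‖((max r 0 + n : ℝ) : ℂ)‖
      rw [hnormeq]
      exact (le_max_left r 0).trans (le_add_of_nonneg_right n.cast_nonneg)
    have hsμ := OperatorPencil.tendsto_norm_sub_const hs μ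
    refine ⟨fun n => ((max r 0 + n : ℝ) : ℂ), hmem, hs, ?_, ?_⟩
    · rw [growth hs]
      exact hO.comp_tendsto (tendsto_norm_atTop_iff_cobounded.1 hsμ)
    · rw [growth hs]
      exact OperatorPencil.not_isBigO_of_isLeast_stationaryExponents hT h hsμ
        (Eventually.of_forall hmem)
  tfae_have 4 → 5 := fun h =>
    ⟨hseq h, OperatorPencil.isClosed_range_pow h.1.2.2 h.1.2.1⟩
  tfae_have 4 → 6 := fun h => ⟨hseq h, m, h.1.2.1⟩
  tfae_have 5 → 4 := by
    rintro ⟨⟨s, hu, hs, hO, hnO⟩, hcl⟩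
    rw [growth hs] at hO hnO
    have hsμ := OperatorPencil.tendsto_norm_sub_const hs μ
    have ha := OperatorPencil.ascentLE_of_isBigO hsμ (Eventually.of_forall hu) hO
    have hd := OperatorPencil.descentLE_of_isBigO_of_isClosed hsμ (Eventually.of_forall hu) hO hcl
    exact OperatorPencil.isLeast_stationaryExponents_of_not_isBigO ⟨hm, hd, ha⟩ hsμ hnO
  tfae_have 6 → 4 := by
    rintro ⟨⟨s, hu, hs, hO, hnO⟩, k, hk⟩
    rw [growth hs] at hO hnO
    have hsμ := OperatorPencil.tendsto_norm_sub_const hs μ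
    have ha := OperatorPencil.ascentLE_of_isBigO hsμ (Eventually.of_forall hu) hO
    -- The descent exponent `k` is arbitrary; the ascent bound `m` transfers stationarity of the
    -- ranges to `m`.
    exact OperatorPencil.isLeast_stationaryExponents_of_not_isBigO
      ⟨hm, hk.of_ascentLE ha, ha⟩ hsμ hnO
  tfae_finish
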